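/- Let $X$ be a real separable Banach space. A Borel set $E\subseteq X$ is \emph{Haar null} if there is a Borel probability measure $\mu$ on $X$ with $\mu(x+E)=0$ for every $x\in X$, and \emph{Haar positive} if it is not Haar null. A set $E\subseteq X$ is \emph{compactivorous} if for every nonempty compact set $K\subseteq X$ there are an open set $V\subseteq X$ and $x\in X$ such that $K\cap V\neq\varnothing$ and $K\cap V\subseteq x+E$. Let $c_0(X)$ be the space of all sequences in $X$ converging to $0$ and, for $\mathbf{x}=(x_1,x_2,\dots)\in c_0(X)$, let $\Sigma(\mathbf{x})=(x_1,-x_1,x_2,-x_2,\dots)$. For a closed, convex, bounded set $C\subseteq X$, a sequence $\mathbf{x}\in c_0(X)$ is called \emph{$C$-fit} if there are $z\in X$ and $\lambda>0$ such that all terms of $z+\Sigma(\mathbf{x})$ belong to $\lambda C$; the set of all $C$-fit sequences is denoted by $F_C(X)$. **Theorem.** Let $C$ be a closed, convex and bounded subset of a real separable Banach space $X$. If $C$ is Haar positive, then $F_C(X)=c_0(X)$. In particular, $C$ is compactivorous. -/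

import Mathlib

open Set Filter Topology MeasureTheory
open scoped ZeroAtInfty Pointwise

/-- A Borel set `E` in an (additively written, not necessarily commutative) group is Haar null if some Borel
probability measure vanishes on all two-sided translates `g + E + h`. -/
def HaarNull {G : Type*} [AddGroup G] [MeasurableSpace G] (E : Set G) : Prop :=
  MeasurableSet E ∧ ∃ μ : Measure G, IsProbabilityMeasure μ ∧
    ∀ g h : G, μ ((fun x => g + x + h) '' E) = 0

/-- A Borel set is Haar positive (nonnegligible) if it is not Haar null. -/
def HaarPositive {G : Type*} [AddGroup G] [MeasurableSpace G] (E : Set G) : Prop :=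
  MeasurableSet E ∧ ¬ HaarNull E

/-- `E` is compactivorous if every nonempty compact set `K` has a nonempty relatively open subset
`K ∩ V` contained in some translate `g + E + h`. -/
def Compactivorous {G : Type*} [AddGroup G] [TopologicalSpace G] (E : Set G) : Prop :=
  ∀ K : Set G, IsCompact K → K.Nonempty →
    ∃ V : Set G, IsOpen V ∧ ∃ g h : G,
      (K ∩ V).Nonempty ∧ K ∩ V ⊆ (fun x => g + x + h) '' E

/-- The symmetrisation operator `(x₀, x₁, …) ↦ (x₀, -x₀, x₁, -x₁, …)` on the space `c₀(X)` of null
sequences of `X`, which is `C₀(ℕ, X)`. -/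
def symmetrisation {X : Type*} [NormedAddCommGroup X] (x : C₀(ℕ, X)) : C₀(ℕ, X) where
  toFun n := if Even n then x (n / 2) else -x (n / 2)
  continuous_toFun := continuous_of_discreteTopology
  zero_at_infty' := by
    have hx : Tendsto (fun n : ℕ => x n) atTop (𝓝 0) := by
      have h := x.zero_at_infty'
      rw [cocompact_eq_cofinite, Nat.cofinite_eq_atTop] at h
      exact h
    have hd : Tendsto (fun n : ℕ => n / 2) atTop atTop :=
      Nat.tendsto_div_const_atTop (by norm_num)
    have h2 := tendsto_zero_iff_norm_tendsto_zero.mp (hx.comp hd)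
    rw [cocompact_eq_cofinite, Nat.cofinite_eq_atTop]
    refine tendsto_zero_iff_norm_tendsto_zero.mpr (h2.congr fun n => ?_)
    by_cases hn : Even n <;> simp [hn]

/-- A null sequence `x` is `C`-fit if `z + Σ(x) ⊆ λ C` for some `z ∈ X` and `λ > 0`. -/
def IsFit {X : Type*} [NormedAddCommGroup X] [NormedSpace ℝ X] (C : Set X) (x : C₀(ℕ, X)) :
    Prop :=
  ∃ (z : X) (l : ℝ), 0 < l ∧ ∀ n : ℕ, z + symmetrisation x n ∈ l • C

/-- The set `F_C(X)` of all `C`-fit sequences in `c₀(X)`. -/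
def fitSequences {X : Type*} [NormedAddCommGroup X] [NormedSpace ℝ X] (C : Set X) :
    Set C₀(ℕ, X) :=
  {x | IsFit C x}

/-!
The two halves of the statement are consequences of one fact about a Haar positive, bounded, closed
convex set `C` (`HaarPositive.exists_translate_tsum_mem`): if finite sets `D k` shrink
like `8⁻ᵏ`, then, from some index `K` on, all the sums `∑ j, d j` with `d j ∈ D (K + j)` lie in one
translate of `C`.

This rests on a dichotomy for a finite set `D` (`exists_center_or_exists_measure`), which is the
minimax theorem in the form of a Hahn-Banach separation in `D → ℝ`. Either some `z` has
`z ± d / 2 ∈ C` for all `d ∈ D`, or there is a probability law on `D ∪ -D` under which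
every translate of `C` has mass at most `7 / 8`. If the second alternative held
for `2ᵏ⁺¹ • D k` for infinitely many `k`, let `S` be the sum of independent
random vectors with these laws. Conditionally on any finite number of terms, `S` lies in a given
translate of `C` with probability at most `7 / 8`; since an event is approximated by events
depending on finitely many terms, that probability is `0`, and the law of `S` shows that `C` is
Haar null (`haarNull_of_frequently_concentration_le`). Hence for all large `k` some `w` has
`w ± 2ᵏ • d ∈ C` for all `d ∈ D k`. As the scaling factors beat the weights `2⁻ʲ⁻¹`, one countable
convex combination of such points absorbs all selections at once.

For a null sequence `x`, let `D k` consist of the terms of size about `8⁻ᵏ` with both signs,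
together with scaled copies of the finitely many larger terms: this makes `x` fit. For a compact
set, let `D k` consist of the differences of points in successive finite nets: a point of the
compact set near a fixed point of the `K`-th net differs from it by a selection sum, which makes
`C` compactivorous.
-/

/-! ### Resampling one coordinate of an infinite product measure -/

/-- Resampling one coordinate of an infinite product of probability measures does not change the
law: the form in which the independence of one term of a random series from the others is used. -/
theorem infinitePi_map_update {ι : Type*} [DecidableEq ι] {Y : ι → Type*}
    [∀ i, MeasurableSpace (Y i)] (μ : ∀ i, Measure (Y i)) [∀ i, IsProbabilityMeasure (μ i)]
    (k : ι) :
    ((Measure.infinitePi μ).prod (μ k)).map (fun q => Function.update q.1 k q.2) =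
      Measure.infinitePi μ := by
  refine Measure.eq_infinitePi μ fun s t ht => ?_
  rw [Measure.map_apply measurable_update' (MeasurableSet.pi s.countable_toSet fun i _ => ht i)]
  have hpre : (fun q : (∀ i, Y i) × Y k => Function.update q.1 k q.2) ⁻¹' (Set.pi s t) =
      (Set.pi (s.erase k : Finset ι) t) ×ˢ (if k ∈ s then t k else univ) := by
    ext q
    simp only [mem_preimage, Set.mem_pi, mem_prod, Finset.coe_erase, Finset.mem_coe,
      Set.mem_sdiff, mem_singleton_iff]
    constructor
    · intro h
      refine ⟨fun i hi => by simpa [Function.update_of_ne hi.2] using h i hi.1, ?_⟩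
      split_ifs with hk
      · simpa using h k hk
      · trivial
    · rintro ⟨h1, h2⟩ i hi
      by_cases hik : i = k
      · subst hik; simpa [hi] using h2
      · simpa [Function.update_of_ne hik] using h1 i ⟨hi, hik⟩
  rw [hpre, Measure.prod_prod, Measure.infinitePi_pi _ fun i _ => ht i]
  split_ifs with hk
  · rw [Finset.prod_erase_mul _ _ hk]
  · simp [Finset.erase_eq_of_notMem hk]

/-- A set that fills at most a fixed fraction `c < 1` of every member of a generating algebra is
null: members of the algebra approximate the set itself. -/
theorem measure_eq_zero_of_inter_le {Ω : Type*} [m : MeasurableSpace Ω] (μ : Measure Ω)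
    [IsFiniteMeasure μ] {𝒜 : Set (Set Ω)} (h𝒜 : IsSetAlgebra 𝒜)
    (hgen : m = MeasurableSpace.generateFrom 𝒜) {A : Set Ω} (hA : MeasurableSet A) {c : ℝ}
    (hc0 : 0 ≤ c) (hc : c < 1) (h : ∀ Q ∈ 𝒜, μ.real (A ∩ Q) ≤ c * μ.real Q) : μ A = 0 := by
  have hle : ∀ ε > 0, μ.real A * (1 - c) ≤ 2 * ε := by
    intro ε hε
    obtain ⟨Q, hQ, hQA⟩ :=
      (Measure.MeasureDense.of_generateFrom_isSetAlgebra_finite μ h𝒜 hgen).approx A hA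
        (measure_ne_top _ _) ε hε
    have hlt : μ.real (symmDiff A Q) < ε := by
      rw [measureReal_def]
      exact (ENNReal.lt_ofReal_iff_toReal_lt (measure_ne_top _ _)).1 hQA
    have h1 : μ.real A ≤ μ.real (A ∩ Q) + μ.real (symmDiff A Q) := by
      refine (measureReal_mono ?_).trans (measureReal_union_le _ _)
      intro x hx
      by_cases hxQ : x ∈ Q
      · exact Or.inl ⟨hx, hxQ⟩
      · exact Or.inr (Or.inl ⟨hx, hxQ⟩)
    have h2 : μ.real Q ≤ μ.real A + μ.real (symmDiff A Q) := by
      refine (measureReal_mono ?_).trans (measureReal_union_le _ _)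
      intro x hx
      by_cases hxA : x ∈ A
      · exact Or.inl hxA
      · exact Or.inr (Or.inr ⟨hx, hxA⟩)
    nlinarith [h Q hQ]
  have h0 : μ.real A * (1 - c) ≤ 0 := by
    refine le_of_forall_pos_le_add fun ε hε => ?_
    linarith [hle (ε / 2) (by positivity)]
  have h1 : μ.real A = 0 := by
    have := measureReal_nonneg (μ := μ) (s := A)
    nlinarith
  exact (measureReal_eq_zero_iff).1 h1

/-! ### Laws of random series that charge no translate of a closed set -/

/-- If infinitely many terms of a convergent random series with independent terms miss every
translate of the closed set `C` with probability bounded below, then the law of the sum vanishes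
on every translate of `C`: conditionally on finitely many terms, the sum lands in a given
translate with probability at most `c < 1`. -/
theorem haarNull_of_frequently_concentration_le {X : Type*} [NormedAddCommGroup X]
    [CompleteSpace X] [TopologicalSpace.SeparableSpace X] [MeasurableSpace X] [BorelSpace X]
    {C : Set X} (hC : IsClosed C) {r : ℕ → ℝ} (hr : Summable r)
    (ν : ∀ k, Measure (Metric.closedBall (0 : X) (r k))) [∀ k, IsProbabilityMeasure (ν k)]
    {c : ℝ} (hc0 : 0 ≤ c) (hc : c < 1)
    (hν : ∃ᶠ k in atTop, ∀ z : X, ν k {x | z + x ∈ C} ≤ ENNReal.ofReal c) :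
    HaarNull C := by
  classical
  have : SecondCountableTopology X := UniformSpace.secondCountable_of_separable X
  refine ⟨hC.measurableSet, ?_⟩
  let S : (∀ k, Metric.closedBall (0 : X) (r k)) → X := fun ω => ∑' k, (ω k : X)
  have hnorm : ∀ k (ω : ∀ k, Metric.closedBall (0 : X) (r k)), ‖(ω k : X)‖ ≤ r k :=
    fun k ω => mem_closedBall_zero_iff.1 (ω k).2
  have hsum : ∀ ω : (∀ k, Metric.closedBall (0 : X) (r k)), Summable fun k => (ω k : X) :=
    fun ω => Summable.of_norm_bounded hr fun k => hnorm k ω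
  have hS : Measurable S :=
    (continuous_tsum (fun k => by fun_prop) hr hnorm).measurable
  refine ⟨(Measure.infinitePi ν).map S, Measure.isProbabilityMeasure_map hS.aemeasurable,
    fun g h => ?_⟩
  have himage : (fun x => g + x + h) '' C = (fun y => y - (g + h)) ⁻¹' C := by
    ext y
    constructor
    · rintro ⟨x, hx, rfl⟩
      simpa [mem_preimage, show g + x + h - (g + h) = x by abel] using hx
    · intro hy
      exact ⟨y - (g + h), hy, by simp only; abel⟩
  have hmC : MeasurableSet ((fun x => g + x + h) '' C) := by
    rw [himage]
    exact (hC.preimage (by fun_prop)).measurableSet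
  rw [Measure.map_apply hS hmC]
  refine measure_eq_zero_of_inter_le _ isSetAlgebra_measurableCylinders
    generateFrom_measurableCylinders.symm (hS hmC) hc0 hc fun Q hQ => ?_
  have hQm : MeasurableSet Q := MeasurableSet.of_mem_measurableCylinders hQ
  obtain ⟨s, T, -, rfl⟩ := (mem_measurableCylinders Q).1 hQ
  -- A coordinate beyond those on which the cylinder depends.
  obtain ⟨k, hk, hνk⟩ := frequently_atTop.1 hν (s.sup id + 1)
  have hks : k ∉ s := fun hmem => by
    have := Finset.le_sup (f := id) hmem
    simp only [id] at this
    omega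
  have hres : ∀ (ω : ∀ k, Metric.closedBall (0 : X) (r k)) (x : Metric.closedBall (0 : X) (r k)),
      Function.update ω k x ∈ cylinder s T ↔ ω ∈ cylinder s T := by
    intro ω x
    rw [mem_cylinder, mem_cylinder]
    have : s.restrict (Function.update ω k x) = s.restrict ω := by
      ext1 i
      exact Function.update_of_ne (fun h => hks (by rw [← h]; exact i.2)) _ _
    rw [this]
  have hSup : ∀ (ω : ∀ k, Metric.closedBall (0 : X) (r k)) (x : Metric.closedBall (0 : X) (r k)),
      S (Function.update ω k x) = S ω - ω k + x := by
    intro ω x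
    have h1 : S (Function.update ω k x) - S ω =
        ∑' j, ((Function.update ω k x j : X) - (ω j : X)) :=
      ((hsum _).tsum_sub (hsum _)).symm
    have h2 : ∑' j, ((Function.update ω k x j : X) - (ω j : X)) = (x : X) - ω k := by
      rw [tsum_eq_single k]
      · simp
      · intro j hj
        simp [Function.update_of_ne hj]
    rw [h2] at h1
    rw [eq_add_of_sub_eq h1]
    abel
  have hmain : Measure.infinitePi ν (S ⁻¹' ((fun x => g + x + h) '' C) ∩ cylinder s T) ≤
      ENNReal.ofReal c * Measure.infinitePi ν (cylinder s T) := by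
    conv_lhs => rw [← infinitePi_map_update ν k]
    rw [Measure.map_apply measurable_update' ((hS hmC).inter hQm),
      Measure.prod_apply (measurable_update' ((hS hmC).inter hQm))]
    calc _ ≤ ∫⁻ ω, (cylinder s T).indicator (fun _ => ENNReal.ofReal c) ω
          ∂(Measure.infinitePi ν) := by
          refine lintegral_mono fun ω => ?_
          by_cases hω : ω ∈ cylinder s T
          · rw [indicator_of_mem hω]
            refine (measure_mono ?_).trans (hνk (S ω - ω k - (g + h)))
            rintro x ⟨hx, -⟩
            rw [himage] at hx
            have hx' : S (Function.update ω k x) - (g + h) ∈ C := hx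
            rw [hSup] at hx'
            rw [mem_ofPred_eq]
            convert hx' using 1
            abel
          · rw [indicator_of_notMem hω]
            refine le_of_eq ?_
            convert measure_empty (μ := ν k)
            refine eq_empty_of_forall_notMem fun x hx => hω ((hres ω x).1 hx.2)
      _ = _ := by rw [lintegral_indicator_const hQm]
  rw [measureReal_def, measureReal_def]
  calc _ ≤ (ENNReal.ofReal c * Measure.infinitePi ν (cylinder s T)).toReal :=
        ENNReal.toReal_mono (ENNReal.mul_ne_top ENNReal.ofReal_ne_top (measure_ne_top _ _)) hmain
    _ = _ := by rw [ENNReal.toReal_mul, ENNReal.toReal_ofReal hc0]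

/-! ### A minimax alternative for finite sets -/

theorem Convex.add_smul_mem_of_abs_le {X : Type*} [AddCommGroup X] [Module ℝ X] {C : Set X}
    (hC : Convex ℝ C) {z d : X} {s t : ℝ} (h1 : z + s • d ∈ C) (h2 : z - s • d ∈ C)
    (ht : |t| ≤ s) : z + t • d ∈ C := by
  have hconv : Convex ℝ {a : ℝ | z + a • d ∈ C} := by
    have h : {a : ℝ | z + a • d ∈ C} = (AffineMap.lineMap z (z + d) : ℝ →ᵃ[ℝ] X) ⁻¹' C := by
      ext a
      simp [AffineMap.lineMap_apply, add_comm]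
    rw [h]
    exact hC.affine_preimage _
  have hs : s ∈ {a : ℝ | z + a • d ∈ C} := h1
  have hs' : -s ∈ {a : ℝ | z + a • d ∈ C} := by simpa [sub_eq_add_neg] using h2
  exact hconv.ordConnected.out hs' hs (abs_le.1 ht)

/-- A finite set `D` either has all its points, halved and with both signs, in one translate of
the convex set `C`, or carries a symmetric probability law whose translates charge `C` with mass
at most `7/8`. The law comes from a functional on `D → ℝ` separating the vectors all of whose
coordinates exceed `1/2` from the convex set of those `v` for which some `z` has all
`z ± v d • d` in `C`. -/
theorem exists_center_or_exists_measure {X : Type*} [NormedAddCommGroup X] [NormedSpace ℝ X]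
    [MeasurableSpace X] [BorelSpace X] {C : Set X} (hclosed : IsClosed C) (hC : Convex ℝ C)
    (hne : C.Nonempty) (D : Finset X) {r : ℝ} (hD : ∀ d ∈ D, ‖d‖ ≤ r) :
    (∃ z : X, ∀ d ∈ D, z + (1 / 2 : ℝ) • d ∈ C ∧ z - (1 / 2 : ℝ) • d ∈ C) ∨
      ∃ ν : Measure (Metric.closedBall (0 : X) r), IsProbabilityMeasure ν ∧
        ∀ z : X, ν {x | z + x ∈ C} ≤ ENNReal.ofReal (7 / 8) := by
  classical
  let H : Set (D → ℝ) := {v | ∃ z : X, ∀ i : D, z + v i • (i : X) ∈ C ∧ z - v i • (i : X) ∈ C}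
  have hH : Convex ℝ H := by
    rintro v ⟨z, hz⟩ w ⟨y, hy⟩ a b ha hb hab
    refine ⟨a • z + b • y, fun i => ⟨?_, ?_⟩⟩
    · convert hC (hz i).1 (hy i).1 ha hb hab using 1
      simp only [Pi.add_apply, Pi.smul_apply, smul_eq_mul]
      module
    · convert hC (hz i).2 (hy i).2 ha hb hab using 1
      simp only [Pi.add_apply, Pi.smul_apply, smul_eq_mul]
      module
  by_cases hdisj : Disjoint (Set.pi univ fun _ : D => Ioi (1 / 2 : ℝ)) H
  swap
  · left
    obtain ⟨v, hv, z, hz⟩ := Set.not_disjoint_iff.1 hdisj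
    refine ⟨z, fun d hd => ?_⟩
    have hvd : (1 / 2 : ℝ) < v ⟨d, hd⟩ := hv ⟨d, hd⟩ (mem_univ _)
    refine ⟨hC.add_smul_mem_of_abs_le (hz ⟨d, hd⟩).1 (hz ⟨d, hd⟩).2 ?_, ?_⟩
    · rw [abs_of_pos (by norm_num)]; exact hvd.le
    · rw [sub_eq_add_neg, ← neg_smul]
      refine hC.add_smul_mem_of_abs_le (hz ⟨d, hd⟩).1 (hz ⟨d, hd⟩).2 ?_
      rw [abs_neg, abs_of_pos (by norm_num)]; exact hvd.le
  right
  obtain ⟨f, u, hfO, hfH⟩ := geometric_hahn_banach_open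
    (convex_pi fun _ _ => convex_Ioi (1 / 2 : ℝ)) (isOpen_set_pi finite_univ fun _ _ => isOpen_Ioi)
    hH hdisj
  let q : D → ℝ := fun i => -f (Pi.single i 1)
  have hf : ∀ v : D → ℝ, f v = -∑ i, v i * q i := by
    intro v
    conv_lhs => rw [← Finset.univ_sum_single v]
    rw [map_sum, ← Finset.sum_neg_distrib]
    refine Finset.sum_congr rfl fun i _ => ?_
    have : (Pi.single i (v i) : D → ℝ) = v i • Pi.single i (1 : ℝ) := by
      rw [← Pi.single_smul]; simp
    rw [this, map_smul]
    simp [q]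
  -- The orthant is stable under increasing a coordinate, so `f` is nonpositive on basis vectors.
  have hq : ∀ i, 0 ≤ q i := by
    intro i
    by_contra hneg
    push Not at hneg
    obtain ⟨n, hn⟩ := exists_nat_gt ((u - f fun _ => 1) / (-q i))
    have hmem : ((fun _ => 1) + (n : ℝ) • Pi.single i 1 : D → ℝ) ∈
        Set.pi univ fun _ : D => Ioi (1 / 2 : ℝ) := by
      intro j _
      have : 0 ≤ (n : ℝ) * (Pi.single i 1 : D → ℝ) j := by
        refine mul_nonneg n.cast_nonneg ?_
        by_cases h : j = i
        · subst h; simp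
        · simp [Pi.single_eq_of_ne h]
      simp only [Pi.add_apply, Pi.smul_apply, smul_eq_mul, mem_Ioi]
      linarith
    have h1 := hfO _ hmem
    rw [map_add, map_smul, smul_eq_mul] at h1
    have h2 : f (Pi.single i 1) = -q i := by simp [q]
    rw [h2] at h1
    rw [div_lt_iff₀ (by linarith)] at hn
    linarith
  have hu : -u < 3 / 4 * ∑ i, q i := by
    have := hfO (fun _ => 3 / 4) fun _ _ => by simp only [mem_Ioi]; norm_num
    rw [hf, ← Finset.mul_sum] at this
    linarith
  have hHq : ∀ v ∈ H, ∑ i, v i * q i < 3 / 4 * ∑ i, q i := by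
    intro v hv
    have := hfH v hv
    rw [hf] at this
    linarith
  have hQ : 0 < ∑ i, q i := by
    obtain ⟨c, hc⟩ := hne
    have := hHq 0 ⟨c, fun i => by simpa using hc⟩
    simp only [Pi.zero_apply, zero_mul, Finset.sum_const_zero] at this
    linarith
  let p : D → ℝ := fun i => q i / ∑ i, q i
  have hp : ∀ i, 0 ≤ p i := fun i => div_nonneg (hq i) hQ.le
  have hp1 : ∑ i, p i = 1 := by
    rw [← Finset.sum_div, div_self hQ.ne']
  have hHp : ∀ v ∈ H, ∑ i, v i * p i < 3 / 4 := by
    intro v hv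
    have : ∑ i, v i * p i = (∑ i, v i * q i) / ∑ i, q i := by
      rw [Finset.sum_div]
      exact Finset.sum_congr rfl fun i _ => by simp only [p]; ring
    rw [this, div_lt_iff₀ hQ]
    exact hHq v hv
  let a : D → Metric.closedBall (0 : X) r :=
    fun i => ⟨i, mem_closedBall_zero_iff.2 (hD i i.2)⟩
  let b : D → Metric.closedBall (0 : X) r :=
    fun i => ⟨-i, mem_closedBall_zero_iff.2 (by rw [norm_neg]; exact hD i i.2)⟩
  refine ⟨∑ i : D, ENNReal.ofReal (p i / 2) • (Measure.dirac (a i) + Measure.dirac (b i)),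
    ⟨?_⟩, fun z => ?_⟩
  · simp only [Measure.coe_finsetSum, Finset.sum_apply, Measure.smul_apply, Measure.add_apply,
      measure_univ, smul_eq_mul]
    have : ∀ i, ENNReal.ofReal (p i / 2) * (1 + 1) = ENNReal.ofReal (p i) := by
      intro i
      rw [one_add_one_eq_two, ← ENNReal.ofReal_ofNat, ← ENNReal.ofReal_mul (by linarith [hp i])]
      congr 1; ring
    simp only [this]
    rw [← ENNReal.ofReal_sum_of_nonneg fun i _ => hp i, hp1, ENNReal.ofReal_one]
  · have hE : MeasurableSet {x : Metric.closedBall (0 : X) r | z + x ∈ C} :=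
      (hclosed.preimage (f := fun x : Metric.closedBall (0 : X) r => z + (x : X))
        (by fun_prop)).measurableSet
    let g : D → ℝ := fun i => if z + (i : X) ∈ C ∧ z - (i : X) ∈ C then 1 else 0
    have hg : g ∈ H := by
      by_cases hz : z ∈ C
      · refine ⟨z, fun i => ?_⟩
        by_cases hi : z + (i : X) ∈ C ∧ z - (i : X) ∈ C
        · simp [g, hi]
        · simpa [g, hi] using hz
      · -- If `z ∉ C` then, by convexity, no `z + d` and `z - d` are both in `C`.
        obtain ⟨c, hc⟩ := hne
        refine ⟨c, fun i => ?_⟩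
        have hi : ¬ (z + (i : X) ∈ C ∧ z - (i : X) ∈ C) := fun hi => hz <| by
          have h0 := hC.add_smul_mem_of_abs_le (s := 1) (t := 0) (by rw [one_smul]; exact hi.1)
            (by rw [one_smul]; exact hi.2) (by simp)
          rwa [zero_smul, add_zero] at h0
        simp [g, hi, hc]
    simp only [Measure.coe_finsetSum, Finset.sum_apply, Measure.smul_apply, Measure.add_apply,
      smul_eq_mul, Measure.dirac_apply' _ hE]
    calc _ ≤ ∑ i, ENNReal.ofReal (p i / 2 * (1 + g i)) := by
          refine Finset.sum_le_sum fun i _ => ?_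
          rw [ENNReal.ofReal_mul (by linarith [hp i])]
          gcongr
          simp only [indicator, mem_ofPred_eq, a, b, g, ← sub_eq_add_neg, Pi.one_apply]
          split_ifs <;> first | tauto | (norm_num)
      _ = ENNReal.ofReal (∑ i, p i / 2 * (1 + g i)) := by
          refine (ENNReal.ofReal_sum_of_nonneg fun i _ => ?_).symm
          have : 0 ≤ g i := by simp only [g]; split_ifs <;> norm_num
          have := hp i
          positivity
      _ ≤ _ := by
          refine ENNReal.ofReal_le_ofReal ?_
          have h1 : ∑ i, p i / 2 * (1 + g i) = (∑ i, p i + ∑ i, g i * p i) / 2 := by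
            rw [← Finset.sum_add_distrib, Finset.sum_div]
            exact Finset.sum_congr rfl fun i _ => by ring
          rw [h1, hp1]
          linarith [hHp g hg]

/-! ### Haar positive convex sets absorb rapidly decreasing finite sets -/

theorem HaarPositive.nonempty {G : Type*} [AddGroup G] [MeasurableSpace G] {E : Set G}
    (hE : HaarPositive E) : E.Nonempty := by
  by_contra h
  rw [not_nonempty_iff_eq_empty] at h
  subst h
  exact hE.2 ⟨hE.1, Measure.dirac 0, inferInstance, by simp⟩

/-- If the finite sets `D k` shrink like `8⁻ᵏ`, then for all large `k` the set `D k`, inflated by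
the factor `2ᵏ`, lies with both signs in a translate of `C`. Otherwise the laws of
`exists_center_or_exists_measure` on the exceptional `2ᵏ⁺¹ • D k` generate a random series whose
sum misses every translate of `C` almost surely. -/
theorem HaarPositive.eventually_exists_center {X : Type*} [NormedAddCommGroup X]
    [NormedSpace ℝ X] [CompleteSpace X] [TopologicalSpace.SeparableSpace X] [MeasurableSpace X]
    [BorelSpace X] {C : Set X} (hpos : HaarPositive C) (hclosed : IsClosed C) (hC : Convex ℝ C)
    (D : ℕ → Finset X) (hD : ∀ k, ∀ d ∈ D k, ‖d‖ ≤ (1 / 8) ^ k) :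
    ∀ᶠ k in atTop, ∃ w : X, ∀ d ∈ D k, ∀ t : ℝ, |t| ≤ 2 ^ k → w + t • d ∈ C := by
  classical
  by_contra hcon
  let P : ℕ → Prop := fun k => ∃ w : X, ∀ d ∈ D k, ∀ t : ℝ, |t| ≤ 2 ^ k → w + t • d ∈ C
  let r : ℕ → ℝ := fun k => 2 * (1 / 4) ^ k
  have hr : Summable r :=
    (summable_geometric_of_lt_one (by norm_num) (by norm_num)).mul_left 2
  have key : ∀ k, ∃ ν : Measure (Metric.closedBall (0 : X) (r k)), IsProbabilityMeasure ν ∧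
      (¬ P k → ∀ z : X, ν {x | z + x ∈ C} ≤ ENNReal.ofReal (7 / 8)) := by
    intro k
    by_cases hk : P k
    · exact ⟨Measure.dirac ⟨0, by simp [r]⟩, inferInstance, fun h => absurd hk h⟩
    have hbound : ∀ d ∈ (D k).image fun d => (2 ^ (k + 1) : ℝ) • d, ‖d‖ ≤ r k := by
      intro d hd
      obtain ⟨e, he, rfl⟩ := Finset.mem_image.1 hd
      rw [norm_smul, norm_pow, Real.norm_ofNat]
      calc (2 : ℝ) ^ (k + 1) * ‖e‖ ≤ 2 ^ (k + 1) * (1 / 8) ^ k := by gcongr; exact hD k e he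
        _ = r k := by
          simp only [r]
          rw [pow_succ, mul_right_comm, ← mul_pow, mul_comm]
          norm_num
    rcases exists_center_or_exists_measure hclosed hC hpos.nonempty _ hbound with
      ⟨z, hz⟩ | ⟨ν, hν, h⟩
    · refine absurd ⟨z, fun d hd t ht => ?_⟩ hk
      have h := hz _ (Finset.mem_image_of_mem _ hd)
      rw [smul_smul, show (1 / 2 : ℝ) * 2 ^ (k + 1) = 2 ^ k by rw [pow_succ]; ring] at h
      exact hC.add_smul_mem_of_abs_le h.1 h.2 ht
    · exact ⟨ν, hν, fun _ => h⟩
  choose ν hν1 hν using key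
  exact hpos.2 <| haarNull_of_frequently_concentration_le hclosed hr ν (by norm_num)
    (by norm_num : (7 / 8 : ℝ) < 1) <|
      (not_eventually.1 hcon).mono fun k hk => hν k hk

/-- A bounded closed convex set is closed under countable convex combinations, here with the
weights `2⁻ʲ⁻¹`. -/
theorem Convex.tsum_geometric_smul_mem {X : Type*} [NormedAddCommGroup X] [NormedSpace ℝ X]
    {C : Set X} (hC : Convex ℝ C) (hclosed : IsClosed C) {c : ℕ → X} (hc : ∀ j, c j ∈ C)
    (hsum : Summable fun j => ((1 / 2 : ℝ) ^ (j + 1)) • c j) :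
    ∑' j, ((1 / 2 : ℝ) ^ (j + 1)) • c j ∈ C := by
  -- Partial sums, completed by the remaining mass at `c 0`.
  have hmem : ∀ n, ∀ y ∈ C,
      ∑ j ∈ Finset.range n, ((1 / 2 : ℝ) ^ (j + 1)) • c j + ((1 / 2 : ℝ) ^ n) • y ∈ C := by
    intro n
    induction n with
    | zero => intro y hy; simpa using hy
    | succ n ih =>
      intro y hy
      have h := ih _ (hC (hc n) hy (by norm_num : (0 : ℝ) ≤ 1 / 2)
        (by norm_num : (0 : ℝ) ≤ 1 / 2) (by norm_num))
      rw [Finset.sum_range_succ]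
      convert h using 1
      rw [pow_succ]
      module
  have hlim : Tendsto (fun n => ∑ j ∈ Finset.range n, ((1 / 2 : ℝ) ^ (j + 1)) • c j +
      ((1 / 2 : ℝ) ^ n) • c 0) atTop (𝓝 (∑' j, ((1 / 2 : ℝ) ^ (j + 1)) • c j + (0 : ℝ) • c 0)) :=
    hsum.hasSum.tendsto_sum_nat.add
      ((tendsto_pow_atTop_nhds_zero_of_lt_one (by norm_num) (by norm_num)).smul_const _)
  rw [zero_smul, add_zero] at hlim
  exact hclosed.mem_of_tendsto hlim (Eventually.of_forall fun n => hmem n _ (hc 0))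

/-- If the finite sets `D k` shrink like `8⁻ᵏ`, then a tail of the sequence has all its selection
sums `∑ j, d j`, `d j ∈ D (K + j)`, in a common translate of `C`: with `w j` the centers
for `D (K + j)`, the sum of `2⁻ʲ⁻¹ (w j + 2ʲ⁺¹ d j)` is a countable convex combination of
points of `C`. -/
theorem HaarPositive.exists_translate_tsum_mem {X : Type*} [NormedAddCommGroup X]
    [NormedSpace ℝ X] [CompleteSpace X] [TopologicalSpace.SeparableSpace X] [MeasurableSpace X]
    [BorelSpace X] {C : Set X} (hpos : HaarPositive C) (hclosed : IsClosed C) (hC : Convex ℝ C)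
    (hbounded : Bornology.IsBounded C)
    (D : ℕ → Finset X) (hD : ∀ k, ∀ d ∈ D k, ‖d‖ ≤ (1 / 8) ^ k) :
    ∃ (K : ℕ) (z : X), ∀ d : ℕ → X, (∀ j, d j ∈ D (K + j)) → z + ∑' j, d j ∈ C := by
  obtain ⟨K, hK⟩ := eventually_atTop.1 (hpos.eventually_exists_center hclosed hC D hD)
  choose! w hw using hK
  refine ⟨K + 1, ∑' j, ((1 / 2 : ℝ) ^ (j + 1)) • w (K + 1 + j), fun d hd => ?_⟩
  obtain ⟨M, hM⟩ := hbounded.exists_norm_le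
  have hgeo : Summable fun j : ℕ => (1 / 2 : ℝ) ^ (j + 1) :=
    (summable_nat_add_iff 1).2 (summable_geometric_of_lt_one (by norm_num) (by norm_num))
  have hmem : ∀ j, ∀ t : ℝ, |t| ≤ 2 ^ (j + 1) → w (K + 1 + j) + t • d j ∈ C := fun j t ht =>
    hw _ (by omega) _ (hd j) t
      (ht.trans (pow_le_pow_right₀ (by norm_num) (by omega)))
  have hwsum : Summable fun j : ℕ => ((1 / 2 : ℝ) ^ (j + 1)) • w (K + 1 + j) := by
    refine Summable.of_norm_bounded (hgeo.mul_right M) fun j => ?_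
    rw [norm_smul, Real.norm_of_nonneg (by positivity)]
    gcongr
    exact hM _ (by simpa using hmem j 0 (by simp))
  have hdsum : Summable d := by
    refine Summable.of_norm_bounded
      (summable_geometric_of_lt_one (by norm_num) (by norm_num : (1 / 8 : ℝ) < 1)) fun j => ?_
    exact (hD _ _ (hd j)).trans (pow_le_pow_of_le_one (by norm_num) (by norm_num) (by omega))
  have heq : ∀ j, ((1 / 2 : ℝ) ^ (j + 1)) • (w (K + 1 + j) + (2 ^ (j + 1) : ℝ) • d j) =
      ((1 / 2 : ℝ) ^ (j + 1)) • w (K + 1 + j) + d j := by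
    intro j
    rw [smul_add, smul_smul, ← mul_pow]
    norm_num
  have hsum := hwsum.add hdsum
  simp only [← heq] at hsum
  rw [← hwsum.tsum_add hdsum]
  simp only [← heq]
  exact hC.tsum_geometric_smul_mem hclosed (fun j => hmem j _ (by rw [abs_of_pos (by positivity)]))
    hsum

/-! ### Null sequences are fit -/

theorem ZeroAtInftyContinuousMap.finite_lt_norm {X : Type*} [NormedAddCommGroup X]
    (x : C₀(ℕ, X)) {ε : ℝ} (hε : 0 < ε) : {i | ε < ‖x i‖}.Finite := by
  have hx : Tendsto (fun n : ℕ => x n) atTop (𝓝 0) := by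
    have h := x.zero_at_infty'
    rwa [cocompact_eq_cofinite, Nat.cofinite_eq_atTop] at h
  have h := (tendsto_zero_iff_norm_tendsto_zero.1 hx).eventually_lt_const hε
  rw [← Nat.cofinite_eq_atTop] at h
  refine h.subset fun i hi => ?_
  simpa using (show ε < ‖x i‖ from hi).le

/-- Let `D k` consist of `0` and of the points `± x i` with `‖x i‖ > 8⁻ᵏ⁻¹`, radially projected to
the ball of radius `8⁻ᵏ`. Every `x i` occurs in some `D (K + j)`, undiminished if `‖x i‖ ≤ 8⁻ᴷ`
and scaled by at least a constant otherwise; hence one translate of `C` contains all the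
points `± c • x i` for some constant `c > 0`. -/
theorem HaarPositive.isFit {X : Type*} [NormedAddCommGroup X]
    [NormedSpace ℝ X] [CompleteSpace X] [TopologicalSpace.SeparableSpace X] [MeasurableSpace X]
    [BorelSpace X] {C : Set X} (hpos : HaarPositive C) (hclosed : IsClosed C) (hC : Convex ℝ C)
    (hbounded : Bornology.IsBounded C) (x : C₀(ℕ, X)) : IsFit C x := by
  classical
  have hfin : ∀ k : ℕ, {i | (1 / 8 : ℝ) ^ (k + 1) < ‖x i‖}.Finite :=
    fun k => ZeroAtInftyContinuousMap.finite_lt_norm x (by positivity)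
  let s : ℕ → ℕ → ℝ := fun k i => min 1 ((1 / 8) ^ k / ‖x i‖)
  have hs0 : ∀ k i, 0 ≤ s k i := fun k i => le_min zero_le_one (by positivity)
  have hs : ∀ k i, ‖s k i • x i‖ ≤ (1 / 8) ^ k := by
    intro k i
    rw [norm_smul, Real.norm_of_nonneg (hs0 k i)]
    rcases (norm_nonneg (x i)).eq_or_lt with h | h
    · rw [← h, mul_zero]; positivity
    · exact (mul_le_mul_of_nonneg_right (min_le_right _ _) h.le).trans_eq (div_mul_cancel₀ _ h.ne')
  let D : ℕ → Finset X := fun k => insert 0 (((hfin k).toFinset.image fun i => s k i • x i) ∪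
    ((hfin k).toFinset.image fun i => -(s k i • x i)))
  have hD : ∀ k, ∀ d ∈ D k, ‖d‖ ≤ (1 / 8) ^ k := by
    intro k d hd
    simp only [D, Finset.mem_insert, Finset.mem_union, Finset.mem_image] at hd
    rcases hd with rfl | ⟨i, -, rfl⟩ | ⟨i, -, rfl⟩
    · rw [norm_zero]; positivity
    · exact hs k i
    · rw [norm_neg]; exact hs k i
  obtain ⟨K, z, hz⟩ := hpos.exists_translate_tsum_mem hclosed hC hbounded D hD
  have hsingle : ∀ j, ∀ d ∈ D (K + j), z + d ∈ C := by
    intro j d hd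
    have h := hz (Pi.single j d) fun i => by
      by_cases hij : i = j
      · subst hij; simpa using hd
      · simp [Pi.single_eq_of_ne hij, D]
    rwa [tsum_pi_single] at h
  obtain ⟨M, hM⟩ : ∃ M : ℝ, ∀ i, ‖x i‖ ≤ M := ⟨‖x.toBCF‖, fun i => x.toBCF.norm_coe_le_norm i⟩
  -- `c` bounds from below the factors by which the `x i` are scaled.
  let c : ℝ := min 1 ((1 / 8) ^ K / (|M| + 1))
  have hc : 0 < c := by positivity
  have hball : ∀ i, z + c • x i ∈ C ∧ z - c • x i ∈ C := by
    intro i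
    obtain ⟨t, hct, h1, h2⟩ : ∃ t, c ≤ t ∧ z + t • x i ∈ C ∧ z - t • x i ∈ C := by
      have hlevel : ∀ j, (1 / 8 : ℝ) ^ (K + j + 1) < ‖x i‖ →
          z + s (K + j) i • x i ∈ C ∧ z - s (K + j) i • x i ∈ C := by
        intro j hj
        have hi : i ∈ (hfin (K + j)).toFinset := (hfin (K + j)).mem_toFinset.2 hj
        refine ⟨hsingle j _ ?_, ?_⟩
        · exact Finset.mem_insert_of_mem (Finset.mem_union_left _
            (Finset.mem_image_of_mem (fun i => s (K + j) i • x i) hi))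
        · rw [sub_eq_add_neg]
          exact hsingle j _ (Finset.mem_insert_of_mem (Finset.mem_union_right _
            (Finset.mem_image_of_mem (fun i => -(s (K + j) i • x i)) hi)))
      rcases eq_or_ne (x i) 0 with h0 | h0
      · have : z ∈ C := by simpa using hsingle 0 0 (by simp [D])
        exact ⟨c, le_rfl, by simpa [h0] using this, by simpa [h0] using this⟩
      have hxi : 0 < ‖x i‖ := norm_pos_iff.2 h0
      by_cases hbig : (1 / 8 : ℝ) ^ K < ‖x i‖
      · refine ⟨s K i, min_le_min le_rfl ?_, hlevel 0 ((pow_lt_pow_right_of_lt_one₀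
          (by norm_num) (by norm_num) (by omega)).trans hbig)⟩
        gcongr
        linarith [hM i, le_abs_self M]
      · push Not at hbig
        obtain ⟨n, hn1, hn2⟩ := exists_nat_pow_near_of_lt_one hxi
          (hbig.trans (pow_le_one₀ (by norm_num) (by norm_num)))
          (by norm_num : (0 : ℝ) < 1 / 8) (by norm_num)
        have hKn : K ≤ n := by
          by_contra! h
          have := (hn1.trans_le hbig)
          rw [pow_lt_pow_iff_right_of_lt_one₀ (by norm_num) (by norm_num)] at this
          omega
        obtain ⟨j, rfl⟩ := Nat.exists_eq_add_of_le hKn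
        refine ⟨s (K + j) i, (min_le_left _ _).trans ?_, hlevel j hn1⟩
        exact le_min le_rfl ((one_le_div hxi).2 hn2)
    refine ⟨hC.add_smul_mem_of_abs_le h1 h2 (by rwa [abs_of_pos hc]), ?_⟩
    rw [sub_eq_add_neg, ← neg_smul]
    exact hC.add_smul_mem_of_abs_le h1 h2 (by rwa [abs_neg, abs_of_pos hc])
  refine ⟨c⁻¹ • z, c⁻¹, inv_pos.2 hc, fun n => ?_⟩
  rw [mem_smul_set_iff_inv_smul_mem₀ (inv_pos.2 hc).ne', inv_inv, smul_add,
    smul_inv_smul₀ hc.ne']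
  change z + c • (if Even n then x (n / 2) else -x (n / 2)) ∈ C
  split_ifs
  · exact (hball _).1
  · rw [smul_neg, ← sub_eq_add_neg]
    exact (hball _).2

/-! ### Compactivorousness -/

/-- Every point of a compact set `A` is the sum of a point of a finite net and of successive
differences between points of finer and finer nets, which belong to finite sets shrinking
like `8⁻ᵏ`; on the part of `A` that starts at a given point of the `K`-th net, all tails
of such sums are in a common translate of `C`. -/
theorem HaarPositive.compactivorous {X : Type*} [NormedAddCommGroup X]
    [NormedSpace ℝ X] [CompleteSpace X] [TopologicalSpace.SeparableSpace X] [MeasurableSpace X]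
    [BorelSpace X] {C : Set X} (hpos : HaarPositive C) (hclosed : IsClosed C) (hC : Convex ℝ C)
    (hbounded : Bornology.IsBounded C) : Compactivorous C := by
  classical
  intro A hA hAne
  have hnet : ∀ k : ℕ, ∃ N : Finset X, (N : Set X) ⊆ A ∧
      ∀ y ∈ A, ∃ a ∈ N, ‖y - a‖ < (1 / 8) ^ k / 2 := by
    intro k
    obtain ⟨t, htA, ht, hcov⟩ := hA.finite_cover_balls (e := (1 / 8 : ℝ) ^ k / 2) (by positivity)
    refine ⟨ht.toFinset, by simpa using htA, fun y hy => ?_⟩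
    obtain ⟨a, ha, hya⟩ := mem_iUnion₂.1 (hcov hy)
    exact ⟨a, ht.mem_toFinset.2 ha, by simpa [dist_eq_norm] using hya⟩
  choose N hNA hN using hnet
  let D : ℕ → Finset X := fun k =>
    (((N (k + 1)) ×ˢ (N k)).image fun q => q.1 - q.2).filter fun d => ‖d‖ ≤ (1 / 8) ^ k
  obtain ⟨K, z, hz⟩ := hpos.exists_translate_tsum_mem hclosed hC hbounded D
    fun k d hd => (Finset.mem_filter.1 hd).2
  obtain ⟨y₀, hy₀⟩ := hAne
  obtain ⟨a, haN, -⟩ := hN K y₀ hy₀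
  refine ⟨Metric.ball a ((1 / 8) ^ K / 2), Metric.isOpen_ball, a - z, 0,
    ⟨a, hNA K haN, Metric.mem_ball_self (by positivity)⟩, ?_⟩
  rintro y ⟨hyA, hya⟩
  have happrox : ∀ j, ∃ b ∈ N (K + j), ‖y - b‖ < (1 / 8) ^ (K + j) / 2 ∧ (j = 0 → b = a) := by
    intro j
    rcases Nat.eq_zero_or_pos j with rfl | hj
    · exact ⟨a, haN, by simpa [dist_eq_norm] using hya, fun _ => rfl⟩
    · obtain ⟨b, hb, hyb⟩ := hN (K + j) y hyA
      exact ⟨b, hb, hyb, fun h => absurd h hj.ne'⟩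
  choose b hbN hyb hb0 using happrox
  have hd : ∀ j, b (j + 1) - b j ∈ D (K + j) := by
    intro j
    refine Finset.mem_filter.2 ⟨Finset.mem_image.2 ⟨(b (j + 1), b j),
      Finset.mem_product.2 ⟨hbN (j + 1), hbN j⟩, rfl⟩, ?_⟩
    have h1 : b (j + 1) - b j = (y - b j) - (y - b (j + 1)) := by abel
    have h2 : (1 / 8 : ℝ) ^ (K + (j + 1)) ≤ (1 / 8) ^ (K + j) :=
      pow_le_pow_of_le_one (by norm_num) (by norm_num) (by omega)
    rw [h1]
    linarith [norm_sub_le (y - b j) (y - b (j + 1)), hyb j, hyb (j + 1)]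
  have hlim : Tendsto b atTop (𝓝 y) := by
    rw [tendsto_iff_norm_sub_tendsto_zero]
    refine squeeze_zero (fun _ => norm_nonneg _) (fun j => ?_)
      (tendsto_pow_atTop_nhds_zero_of_lt_one (by norm_num) (by norm_num : (1 / 8 : ℝ) < 1))
    have h2 : (1 / 8 : ℝ) ^ (K + j) ≤ (1 / 8) ^ j :=
      pow_le_pow_of_le_one (by norm_num) (by norm_num) (by omega)
    have h3 : (0 : ℝ) < (1 / 8) ^ (K + j) := by positivity
    rw [norm_sub_rev]
    linarith [hyb j]
  have htsum : ∑' j, (b (j + 1) - b j) = y - a := by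
    have hsum : Summable fun j => b (j + 1) - b j := by
      refine Summable.of_norm_bounded
        (summable_geometric_of_lt_one (by norm_num) (by norm_num : (1 / 8 : ℝ) < 1)) fun j => ?_
      exact (Finset.mem_filter.1 (hd j)).2.trans
        (pow_le_pow_of_le_one (by norm_num) (by norm_num) (by omega))
    refine tendsto_nhds_unique hsum.hasSum.tendsto_sum_nat ?_
    simp only [Finset.sum_range_sub, hb0 0 rfl]
    exact hlim.sub_const a
  have hmem := hz _ hd
  rw [htsum] at hmem
  exact ⟨_, hmem, by simp only; abel⟩

theorem mainTheorem2 {X : Type*} [NormedAddCommGroup X] [NormedSpace ℝ X] [CompleteSpace X]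
    [TopologicalSpace.SeparableSpace X] [MeasurableSpace X] [BorelSpace X]
    (C : Set X) (hclosed : IsClosed C) (hconvex : Convex ℝ C) (hbounded : Bornology.IsBounded C)
    (hpos : HaarPositive C) :
    fitSequences C = Set.univ ∧ Compactivorous C :=
  ⟨eq_univ_of_forall fun x => hpos.isFit hclosed hconvex hbounded x,
    hpos.compactivorous hclosed hconvex hbounded⟩
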